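/- Let $0\le p\le d$ be integers and let $A\subseteq\mathbb{R}^d$ be locally finite (every compact set contains finitely many points of $A$). The Voronoi domain of $a\in A$ is the set of points $x\in\mathbb{R}^d$ with $\|x-a\|\le\|x-b\|$ for all $b\in A$. The Delaunay mosaic of $A$ consists of the cells $\gamma=\operatorname{conv}S$, where $S\ne\emptyset$ is the set of all points of $A$ nearest to some point of $\mathbb{R}^d$; the Voronoi cell $\gamma^*$ dual to $\gamma$ is the intersection of the Voronoi domains of the points of $A$ in $\gamma$. Let $\mathrm{Gr}(p,d)$ be the Grassmannian of linear $p$-planes in $\mathbb{R}^d$ with its uniform (rotation invariant) probability measure, and equip $\mathbb{R}^d\times\mathrm{Gr}(p,d)$ with the product of Lebesgue measure and this measure. For a $p$-dimensional Delaunay cell $\gamma$ of $A$ (whose dual $\gamma^*$ has dimension $d-p$), the tile $$J(\gamma,\gamma^*)=\{(x,L)\in\mathbb{R}^d\times\mathrm{Gr}(p,d) : x\in\operatorname{proj}_{L+x}(\gamma)\ \text{and}\ (L+x)\cap\gamma^*\neq\emptyset\},$$ where $\operatorname{proj}_{L+x}$ is the orthogonal projection onto $L+x$, is measurable, and its measure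 is $$\operatorname{vol}(J(\gamma,\gamma^*))=\frac{\operatorname{vol}_p(\gamma)\,\operatorname{vol}_{d-p}(\gamma^*)}{\binom{d}{p}},$$ where both sides are infinite if $\operatorname{vol}_{d-p}(\gamma^*)=\infty$. -/

import Mathlib

open MeasureTheory Module

noncomputable section

/-- The Euclidean space `ℝ^d`. -/
abbrev Eucl (d : ℕ) : Type := EuclideanSpace ℝ (Fin d)

/-! ### The Grassmannian and its uniform probability measure -/

/-- The linear Grassmannian `Gr(p, d)`: the `p`-planes through the origin of `ℝ^d`. -/
def Grass (p d : ℕ) : Type := {L : Submodule ℝ (Eucl d) // finrank ℝ L = p}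

/-- The usual topology of the Grassmannian: a plane is identified with the orthogonal projection
of `ℝ^d` onto it. -/
instance Grass.instTopologicalSpace (p d : ℕ) : TopologicalSpace (Grass p d) :=
  TopologicalSpace.induced (fun L => L.1.starProjection) inferInstance

instance Grass.instMeasurableSpace (p d : ℕ) : MeasurableSpace (Grass p d) := borel _

instance Grass.instBorelSpace (p d : ℕ) : BorelSpace (Grass p d) := ⟨rfl⟩

instance Eucl.instContinuousStar (d : ℕ) : ContinuousStar (Eucl d →L[ℝ] Eucl d) :=
  ⟨ContinuousLinearMap.adjoint.continuous⟩

/-- The orthogonal group `O(d)`, as a topological group of operators on `ℝ^d`. -/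
abbrev OrthGroup (d : ℕ) : Type := unitary (Eucl d →L[ℝ] Eucl d)

instance OrthGroup.instCompactSpace (d : ℕ) : CompactSpace (OrthGroup d) := by
  refine isCompact_iff_compactSpace.mp (Metric.isCompact_of_isClosed_isBounded
    isClosed_unitary ((Metric.isBounded_closedBall (x := 0) (r := 1)).subset ?_))
  intro U hU
  rw [mem_closedBall_zero_iff]
  exact ContinuousLinearMap.opNorm_le_bound _ zero_le_one fun x => by
    rw [one_mul]
    exact ((Unitary.linearIsometryEquiv (⟨U, hU⟩ : OrthGroup d)).norm_map x).le

/-- The Haar probability measure on `O(d)`. -/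
def orthHaar (d : ℕ) : Measure (OrthGroup d) := Measure.haarMeasure ⊤

/-- The action of `O(d)` on the Grassmannian: the image of `L` under `U`. -/
def Grass.rotate {p d : ℕ} (U : OrthGroup d) (L : Grass p d) : Grass p d :=
  ⟨L.1.map (Unitary.linearIsometryEquiv U).toLinearEquiv.toLinearMap, by
    rw [LinearEquiv.finrank_map_eq]
    exact L.2⟩

/-- The coordinate `p`-plane spanned by the first `p` vectors of the standard basis. -/
def Grass.coord {p d : ℕ} (hp : p ≤ d) : Grass p d :=
  ⟨Submodule.span ℝ
      (Set.range fun i : Fin p => EuclideanSpace.basisFun (Fin d) ℝ (Fin.castLE hp i)), by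
    have h : LinearIndependent ℝ
        fun i : Fin p => EuclideanSpace.basisFun (Fin d) ℝ (Fin.castLE hp i) :=
      (EuclideanSpace.basisFun (Fin d) ℝ).orthonormal.linearIndependent.comp _
        (Fin.castLE_injective hp)
    simpa using finrank_span_eq_card h⟩

/-- The uniform probability measure on `Gr(p, d)`: the law of `U L₀` for a coordinate plane `L₀`
and a Haar-distributed `U ∈ O(d)`. -/
def grassMeasure {p d : ℕ} (hp : p ≤ d) : Measure (Grass p d) :=
  (orthHaar d).map fun U => Grass.rotate U (Grass.coord hp)

/-- Well-definedness of `grassMeasure`: the orbit map is continuous, hence Borel measurable. -/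
theorem Grass.continuous_rotate {p d : ℕ} (L : Grass p d) :
    Continuous fun U : OrthGroup d => Grass.rotate U L := by
  refine continuous_induced_rng.2 ?_
  have h : ((fun L : Grass p d => L.1.starProjection) ∘ fun U : OrthGroup d => Grass.rotate U L) =
      fun U : OrthGroup d => (U : Eucl d →L[ℝ] Eucl d) * L.1.starProjection *
        ((star U : OrthGroup d) : Eucl d →L[ℝ] Eucl d) := by
    funext U
    ext1 x
    exact Submodule.starProjection_map_apply (Unitary.linearIsometryEquiv U) L.1 x
  rw [h]
  exact (continuous_subtype_val.mul continuous_const).mul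
    (continuous_subtype_val.comp continuous_star)

instance grassMeasure.instIsProbabilityMeasure {p d : ℕ} (hp : p ≤ d) :
    IsProbabilityMeasure (grassMeasure hp) := by
  have : IsProbabilityMeasure (orthHaar d) := ⟨Measure.haarMeasure_self⟩
  exact Measure.isProbabilityMeasure_map
    (Grass.continuous_rotate (Grass.coord hp)).measurable.aemeasurable

/-! ### Voronoi tessellation and Delaunay mosaic -/

/-- The Voronoi domain of the site `a`: the points of `ℝ^d` for which no site in `A` is closer
than `a`. -/
def voronoiDomain {d : ℕ} (A : Set (Eucl d)) (a : Eucl d) : Set (Eucl d) :=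
  {x | ∀ b ∈ A, dist x a ≤ dist x b}

/-- The sites in `A` nearest to `x`. If `A` is locally finite and nonempty, these are the sites on
the largest sphere centered at `x` that encloses no site. -/
def nearestSites {d : ℕ} (A : Set (Eucl d)) (x : Eucl d) : Set (Eucl d) :=
  {a ∈ A | x ∈ voronoiDomain A a}

/-- The Delaunay mosaic of `A`: its cells are the convex hulls of all sites on an empty sphere. -/
def delaunay {d : ℕ} (A : Set (Eucl d)) : Set (Set (Eucl d)) :=
  {γ | ∃ x, (nearestSites A x).Nonempty ∧ γ = convexHull ℝ (nearestSites A x)}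

/-- The Voronoi cell dual to a Delaunay cell `γ`: the common intersection of the Voronoi domains
of the sites in `γ` (these are the vertices of `γ`). -/
def dualVoronoi {d : ℕ} (A γ : Set (Eucl d)) : Set (Eucl d) :=
  ⋂ a ∈ A ∩ γ, voronoiDomain A a

/-- The dimension of a convex set: the dimension of its affine hull. -/
def cellDim {d : ℕ} (C : Set (Eucl d)) : ℕ := finrank ℝ (affineSpan ℝ C).direction

/-! ### Tiles -/

/-- The affine `p`-plane `L + x`. -/
def Grass.through {p d : ℕ} (L : Grass p d) (x : Eucl d) : AffineSubspace ℝ (Eucl d) :=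
  AffineSubspace.mk' x L.1

instance Grass.instNonemptyThrough {p d : ℕ} (L : Grass p d) (x : Eucl d) :
    Nonempty (L.through x) :=
  ⟨⟨x, AffineSubspace.self_mem_mk' x L.1⟩⟩

/-- The `p`-tile of a pair of sets in `ℝ^d`: the point-direction pairs `(x, L)` for which `x` lies
in the orthogonal projection of `γ` onto `L + x`, and `L + x` meets `γ'`. -/
def tile (p : ℕ) {d : ℕ} (γ γ' : Set (Eucl d)) : Set (Eucl d × Grass p d) :=
  {q | q.1 ∈ (fun u => (EuclideanGeometry.orthogonalProjection (q.2.through q.1) u : Eucl d)) '' γ ∧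
    ((q.2.through q.1 : Set (Eucl d)) ∩ γ').Nonempty}

end

/-! Let `P` be the direction of the affine hull of γ. Points of γ* are equidistant from the vertices
of γ, so γ lies in a translate of `P` and γ* in a translate of `Pᗮ`. A pair (x, L) is in the tile
iff x = π_L u + π_{Lᗮ} v with u ∈ γ and v ∈ γ* (`mem_tile_iff`). For fixed L the slice is thus, up
to translation, the image of γ × γ* ⊆ P ⊕ Pᗮ under T = π_L π_P + π_{Lᗮ} π_{Pᗮ}, and has volume |det
T| · vol(γ) · vol(γ*) (`volume_tile_fiber`).

By Fubini it remains to average |det T| over L. In adapted orthonormal bases T is block diagonal,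
and complementary minors of an orthogonal matrix agree up to sign, so |det T| is the square of one p
× p minor (`Submodule.abs_det_projSum`). By rotation invariance all such minors have the same mean
square, and by Cauchy-Binet the squares over all choices of p coordinates sum to 1; the mean is 1 /
(d choose p) (`OrthGroup.lintegral_minor_sq`). -/

/-! ### Determinants -/

/-- The sum over all row selections of the squared maximal minors of a matrix, in the form of the
Cauchy-Binet formula that does not order the rows. -/
theorem Matrix.sum_det_submatrix_sq {m n R : Type*} [Fintype m] [DecidableEq m] [Fintype n]
    [CommRing R] (A : Matrix n m R) :
    ∑ f : m → n, (A.submatrix f id).det ^ 2 =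
      (Fintype.card m).factorial * (A.transpose * A).det := by
  classical
  -- Leibniz expansion of one factor; its signs are absorbed by permuting the rows of the other.
  have key : ∀ f : m → n, (A.submatrix f id).det ^ 2 =
      ∑ τ : Equiv.Perm m, (∏ i, A (f (τ i)) i) * (A.submatrix (f ∘ τ) id).det := by
    intro f
    rw [pow_two]
    nth_rw 1 [Matrix.det_apply']
    rw [Finset.sum_mul]
    refine Finset.sum_congr rfl fun τ _ => ?_
    have h : (A.submatrix (f ∘ τ) id).det = Equiv.Perm.sign τ * (A.submatrix f id).det :=
      Matrix.det_permute τ (A.submatrix f id)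
    rw [h]
    simp only [Matrix.submatrix_apply, id]
    ring
  -- The rows of the Gram matrix are combinations of rows of `A`, so its determinant expands by
  -- multilinearity.
  have gram : (A.transpose * A).det =
      ∑ f : m → n, (∏ i, A (f i) i) * (A.submatrix f id).det := by
    have h := (Matrix.detRowAlternating (R := R) (n := m)).toMultilinearMap.map_sum
      (fun (i : m) (k : n) => A k i • A k)
    have h2 : (fun i : m => ∑ k : n, A k i • A k) = A.transpose * A := by
      funext i
      ext j
      simp [Matrix.mul_apply]
    rw [h2] at h
    refine h.trans (Finset.sum_congr rfl fun f _ => ?_)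
    exact (Matrix.detRowAlternating (R := R) (n := m)).toMultilinearMap.map_smul_univ
      (fun i => A (f i) i) (fun i => A (f i))
  simp_rw [key]
  rw [Finset.sum_comm, gram]
  have h : ∀ τ : Equiv.Perm m,
      ∑ f : m → n, (∏ i, A (f (τ i)) i) * (A.submatrix (f ∘ τ) id).det =
        ∑ f : m → n, (∏ i, A (f i) i) * (A.submatrix f id).det := fun τ =>
    Fintype.sum_equiv (Equiv.arrowCongr τ.symm (Equiv.refl n)) _ _ fun f => rfl
  rw [Finset.sum_congr rfl fun τ _ => h τ, Finset.sum_const, Finset.card_univ,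
    Fintype.card_perm, nsmul_eq_mul]

/-- Complementary diagonal blocks of an orthogonal matrix have the same determinant up to sign. -/
theorem Matrix.abs_det_fromBlocks_zero_of_orthogonal {m n : Type*} [Fintype m] [DecidableEq m]
    [Fintype n] [DecidableEq n] (W : Matrix (m ⊕ n) (m ⊕ n) ℝ) (hW : W * W.transpose = 1) :
    |(Matrix.fromBlocks W.toBlocks₁₁ 0 0 W.toBlocks₂₂).det| = W.toBlocks₁₁.det ^ 2 := by
  have hW' := hW
  rw [← Matrix.fromBlocks_toBlocks W, Matrix.fromBlocks_transpose, Matrix.fromBlocks_multiply,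
    ← Matrix.fromBlocks_one, Matrix.fromBlocks_inj] at hW'
  obtain ⟨h1, -, h3, -⟩ := hW'
  -- The first block column is the transpose of the top block row of `W`. Taking determinants gives
  -- det W · det W₁₁ = det W₂₂.
  have hmul : W * Matrix.fromBlocks W.toBlocks₁₁.transpose 0 W.toBlocks₁₂.transpose 1 =
      Matrix.fromBlocks 1 W.toBlocks₁₂ 0 W.toBlocks₂₂ := by
    nth_rw 1 [← Matrix.fromBlocks_toBlocks W]
    rw [Matrix.fromBlocks_multiply, h1, h3]
    simp
  have hdet := congrArg Matrix.det hmul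
  rw [Matrix.det_mul, Matrix.det_fromBlocks_zero₁₂, Matrix.det_fromBlocks_zero₂₁,
    Matrix.det_transpose] at hdet
  simp only [Matrix.det_one, mul_one, one_mul] at hdet
  have hsq : W.det * W.det = 1 := by
    have := congrArg Matrix.det hW
    rwa [Matrix.det_mul, Matrix.det_transpose, Matrix.det_one] at this
  have habs : |W.det| = 1 := by
    rcases mul_self_eq_one_iff.1 hsq with h | h <;> simp [h]
  rw [Matrix.det_fromBlocks_zero₂₁, ← hdet, abs_mul, abs_mul, habs, one_mul, pow_two,
    abs_mul_abs_self]

/-! ### The determinant of a sum of two composed projections. -/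

section Projections

variable {E : Type*} [NormedAddCommGroup E] [InnerProductSpace ℝ E] [FiniteDimensional ℝ E]

/-- The linear map that projects `P` orthogonally to `L` and `Pᗮ` orthogonally to `Lᗮ`. -/
noncomputable def Submodule.projSum (L P : Submodule ℝ E) : E →L[ℝ] E :=
  L.starProjection * P.starProjection + Lᗮ.starProjection * Pᗮ.starProjection

theorem Submodule.starProjection_span_inl {m n : Type*} [Fintype m] [Fintype n]
    (b : OrthonormalBasis (m ⊕ n) ℝ E) (i : m ⊕ n) :
    (Submodule.span ℝ (Set.range fun k => b (Sum.inl k))).starProjection (b i) =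
      Sum.elim (fun k => b (Sum.inl k)) (fun _ => 0) i := by
  classical
  rcases i with k | k
  · exact Submodule.starProjection_eq_self_iff.2 (Submodule.subset_span ⟨k, rfl⟩)
  · refine (Submodule.starProjection_apply_eq_zero_iff _).2 ?_
    rw [Submodule.mem_orthogonal]
    intro u hu
    induction hu using Submodule.span_induction with
    | mem x hx =>
      obtain ⟨l, rfl⟩ := hx
      exact b.inner_eq_zero (by simp)
    | zero => simp
    | add x y _ _ hx hy => simp [inner_add_left, hx, hy]
    | smul a x _ hx => simp [inner_smul_left, hx]

/-- From basis `c` to basis `b`, the map has the transition matrix `W` with its off-diagonal blocks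
erased. Using different bases on the two sides costs only a factor |det W| = 1. -/
theorem Submodule.abs_det_projSum {m n : Type*} [Fintype m] [DecidableEq m] [Fintype n]
    [DecidableEq n] (b c : OrthonormalBasis (m ⊕ n) ℝ E) :
    |LinearMap.det (Submodule.projSum (Submodule.span ℝ (Set.range fun k => b (Sum.inl k)))
      (Submodule.span ℝ (Set.range fun k => c (Sum.inl k))) : E →ₗ[ℝ] E)| =
    (Matrix.of fun i j : m => inner ℝ (b (Sum.inl i)) (c (Sum.inl j))).det ^ 2 := by
  set L := Submodule.span ℝ (Set.range fun k => b (Sum.inl k)) with hL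
  set P := Submodule.span ℝ (Set.range fun k => c (Sum.inl k)) with hP
  set W : Matrix (m ⊕ n) (m ⊕ n) ℝ := b.toBasis.toMatrix c with hW
  have hWapp : ∀ i j, W i j = inner ℝ (b i) (c j) := fun i j => by
    simp [hW, Basis.toMatrix_apply, OrthonormalBasis.repr_apply_apply]
  have horth : W * W.transpose = 1 := by
    have := b.toMatrix_orthonormalBasis_self_mul_conjTranspose c
    rwa [Matrix.conjTranspose_eq_transpose_of_trivial] at this
  have hsq : W.det * W.det = 1 := by
    have := congrArg Matrix.det horth
    rwa [Matrix.det_mul, Matrix.det_transpose, Matrix.det_one] at this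
  have habs : |W.det| = 1 := by
    rcases mul_self_eq_one_iff.1 hsq with h | h <;> simp [h]
  have hsymm : ∀ x y, inner ℝ x (L.starProjection y) = inner ℝ (L.starProjection x) y :=
    fun x y => (L.starProjection_isSymmetric x y).symm
  have hT : LinearMap.toMatrix c.toBasis b.toBasis (Submodule.projSum L P : E →ₗ[ℝ] E) =
      Matrix.fromBlocks W.toBlocks₁₁ 0 0 W.toBlocks₂₂ := by
    ext i j
    have h : LinearMap.toMatrix c.toBasis b.toBasis (Submodule.projSum L P : E →ₗ[ℝ] E) i j =
        inner ℝ (b i) (L.starProjection (P.starProjection (c j))) +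
          inner ℝ (b i) (Lᗮ.starProjection (Pᗮ.starProjection (c j))) := by
      rw [← inner_add_right, LinearMap.toMatrix_apply, OrthonormalBasis.coe_toBasis,
        OrthonormalBasis.coe_toBasis_repr_apply, OrthonormalBasis.repr_apply_apply]
      rfl
    have hb := Submodule.starProjection_span_inl b i
    have hc := Submodule.starProjection_span_inl c j
    rw [← hL] at hb
    rw [← hP] at hc
    rw [h, Submodule.starProjection_orthogonal_val, Submodule.starProjection_orthogonal_val,
      inner_sub_right, hsymm, hsymm, hb, hc]
    rcases i with i | i <;> rcases j with j | j <;>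
      simp [Matrix.toBlocks₁₁, Matrix.toBlocks₂₂, hWapp]
  have hdet : LinearMap.toMatrix c.toBasis b.toBasis (Submodule.projSum L P : E →ₗ[ℝ] E) =
      W * LinearMap.toMatrix c.toBasis c.toBasis (Submodule.projSum L P : E →ₗ[ℝ] E) := by
    rw [hW, ← OrthonormalBasis.coe_toBasis c, basis_toMatrix_mul_linearMap_toMatrix]
  have := Matrix.abs_det_fromBlocks_zero_of_orthogonal W horth
  rw [← hT, hdet, Matrix.det_mul, abs_mul, habs, one_mul, LinearMap.det_toMatrix] at this
  rw [this]
  congr 2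
  ext i j
  exact hWapp _ _

end Projections

/-! ### The mean squared minor of a random rotation -/

namespace OrthGroup

/-- The isometry of `ℝ^d` given by an element of the orthogonal group. -/
noncomputable abbrev isom {d : ℕ} (U : OrthGroup d) : Eucl d ≃ₗᵢ[ℝ] Eucl d :=
  Unitary.linearIsometryEquiv U

theorem exists_isom_eq {p d : ℕ} (hp : p ≤ d) {g : Fin p → Eucl d} (hg : Orthonormal ℝ g) :
    ∃ V : OrthGroup d, ∀ j,
      isom V (EuclideanSpace.basisFun (Fin d) ℝ (Fin.castLE hp j)) = g j := by
  classical
  set v : Fin d → Eucl d := fun i => if h : (i : ℕ) < p then g ⟨i, h⟩ else 0 with hv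
  have hcast : ∀ j, v (Fin.castLE hp j) = g j := fun j => by simp [hv]
  have horth : Orthonormal ℝ ({i : Fin d | (i : ℕ) < p}.domRestrict v) := by
    have : {i : Fin d | (i : ℕ) < p}.domRestrict v =
        g ∘ fun i : {i : Fin d | (i : ℕ) < p} => (⟨i.1, i.2⟩ : Fin p) := by
      funext i
      have hi : (i.1 : ℕ) < p := i.2
      simp [hv, Set.domRestrict, hi]
    rw [this]
    exact hg.comp _ fun i j h => Subtype.ext (Fin.ext (by simpa using h))
  obtain ⟨b, hb⟩ := horth.exists_orthonormalBasis_extension_of_card_eq (by simp)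
  refine ⟨Unitary.linearIsometryEquiv.symm
    ((EuclideanSpace.basisFun (Fin d) ℝ).equiv b (Equiv.refl _)), fun j => ?_⟩
  rw [isom, MulEquiv.apply_symm_apply, OrthonormalBasis.equiv_apply_basis, Equiv.refl_apply,
    hb _ (by simp), hcast]

/-- The determinant of the inner products of the rotated first `p` standard basis vectors with
a given family of `p` vectors. -/
noncomputable def minor {p d : ℕ} (hp : p ≤ d) (g : Fin p → Eucl d) (U : OrthGroup d) : ℝ :=
  (Matrix.of fun i j : Fin p =>
    inner ℝ (isom U (EuclideanSpace.basisFun (Fin d) ℝ (Fin.castLE hp i))) (g j)).det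

theorem continuous_minor {p d : ℕ} (hp : p ≤ d) (g : Fin p → Eucl d) :
    Continuous (minor hp g) := by
  refine Continuous.matrix_det (continuous_pi fun i => continuous_pi fun j => ?_)
  have h : Continuous fun U : OrthGroup d =>
      (U : Eucl d →L[ℝ] Eucl d) (EuclideanSpace.basisFun (Fin d) ℝ (Fin.castLE hp i)) :=
    continuous_subtype_val.clm_apply continuous_const
  exact h.inner continuous_const

theorem minor_mul {p d : ℕ} (hp : p ≤ d) (g : Fin p → Eucl d) (U V : OrthGroup d) :
    minor hp (fun j => isom V (g j)) (V * U) = minor hp g U := by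
  unfold minor
  congr 2
  ext i j
  rw [isom, map_mul]
  exact (Unitary.linearIsometryEquiv V).inner_map_map _ _

/-- A rotation carries the standard vectors to `g`, and left invariance of Haar measure absorbs it.
-/
theorem lintegral_minor_sq_eq {p d : ℕ} (hp : p ≤ d) {g : Fin p → Eucl d}
    (hg : Orthonormal ℝ g) :
    ∫⁻ U, ENNReal.ofReal (minor hp g U ^ 2) ∂orthHaar d =
      ∫⁻ U, ENNReal.ofReal (minor hp
        (fun j => EuclideanSpace.basisFun (Fin d) ℝ (Fin.castLE hp j)) U ^ 2) ∂orthHaar d := by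
  obtain ⟨V, hV⟩ := exists_isom_eq hp hg
  have : (orthHaar d).IsMulLeftInvariant := by unfold orthHaar; infer_instance
  rw [← lintegral_mul_left_eq_self _ V]
  refine lintegral_congr fun U => ?_
  rw [← minor_mul hp _ U V]
  simp_rw [hV]

/-- Cauchy-Binet for a d × p matrix with orthonormal columns, whose Gram matrix is the identity; p!
counts the orderings of the selected coordinates. -/
theorem sum_minor_sq {p d : ℕ} (hp : p ≤ d) (U : OrthGroup d) :
    ∑ f : Fin p → Fin d, minor hp (fun j => EuclideanSpace.basisFun (Fin d) ℝ (f j)) U ^ 2 =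
      p.factorial := by
  set A : Matrix (Fin d) (Fin p) ℝ := Matrix.of fun k i =>
    inner ℝ (isom U (EuclideanSpace.basisFun (Fin d) ℝ (Fin.castLE hp i)))
      (EuclideanSpace.basisFun (Fin d) ℝ k) with hA
  have h1 : ∀ f : Fin p → Fin d, minor hp (fun j => EuclideanSpace.basisFun (Fin d) ℝ (f j)) U =
      (A.submatrix f id).det := by
    intro f
    rw [← Matrix.det_transpose]
    rfl
  have h2 : A.transpose * A = 1 := by
    ext i j
    have : ∀ k, A k i * A k j =
        inner ℝ (isom U (EuclideanSpace.basisFun (Fin d) ℝ (Fin.castLE hp i)))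
          (EuclideanSpace.basisFun (Fin d) ℝ k) * inner ℝ (EuclideanSpace.basisFun (Fin d) ℝ k)
          (isom U (EuclideanSpace.basisFun (Fin d) ℝ (Fin.castLE hp j))) := by
      intro k
      rw [real_inner_comm (isom U (EuclideanSpace.basisFun (Fin d) ℝ (Fin.castLE hp j)))]
      rfl
    simp only [Matrix.mul_apply, Matrix.transpose_apply]
    rw [Finset.sum_congr rfl fun k _ => this k, OrthonormalBasis.sum_inner_mul_inner,
      LinearIsometryEquiv.inner_map_map, OrthonormalBasis.inner_eq_ite, Matrix.one_apply]
    simp [Fin.ext_iff]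
  simp_rw [h1]
  rw [Matrix.sum_det_submatrix_sq, h2]
  simp

theorem lintegral_minor_sq {p d : ℕ} (hp : p ≤ d) {g : Fin p → Eucl d} (hg : Orthonormal ℝ g) :
    ∫⁻ U, ENNReal.ofReal (minor hp g U ^ 2) ∂orthHaar d = (d.choose p : ENNReal)⁻¹ := by
  classical
  have hprob : IsProbabilityMeasure (orthHaar d) := ⟨Measure.haarMeasure_self⟩
  rw [lintegral_minor_sq_eq hp hg]
  set I := ∫⁻ U, ENNReal.ofReal (minor hp
        (fun j => EuclideanSpace.basisFun (Fin d) ℝ (Fin.castLE hp j)) U ^ 2) ∂orthHaar d with hI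
  -- A repeated coordinate gives two equal columns; all p! · (d choose p) injective selections share
  -- the mean `I`.
  have hterm : ∀ f : Fin p → Fin d, ∫⁻ U, ENNReal.ofReal (minor hp
      (fun j => EuclideanSpace.basisFun (Fin d) ℝ (f j)) U ^ 2) ∂orthHaar d =
      if Function.Injective f then I else 0 := by
    intro f
    split_ifs with hf
    · exact lintegral_minor_sq_eq hp
        ((EuclideanSpace.basisFun (Fin d) ℝ).orthonormal.comp f hf)
    · simp only [Function.Injective, not_forall] at hf
      obtain ⟨i, j, hij, hne⟩ := hf
      have : ∀ U, minor hp (fun j => EuclideanSpace.basisFun (Fin d) ℝ (f j)) U = 0 := fun U =>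
        Matrix.det_zero_of_column_eq hne fun k => by simp [hij]
      simp only [this]
      simp
  have hsum : ∑ f : Fin p → Fin d, ∫⁻ U, ENNReal.ofReal (minor hp
      (fun j => EuclideanSpace.basisFun (Fin d) ℝ (f j)) U ^ 2) ∂orthHaar d =
      (p.factorial : ENNReal) := by
    rw [← lintegral_finsetSum]
    · have : ∀ U : OrthGroup d, ∑ f : Fin p → Fin d, ENNReal.ofReal (minor hp
          (fun j => EuclideanSpace.basisFun (Fin d) ℝ (f j)) U ^ 2) = (p.factorial : ENNReal) := by
        intro U
        rw [← ENNReal.ofReal_sum_of_nonneg fun _ _ => sq_nonneg _, sum_minor_sq,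
          ENNReal.ofReal_natCast]
      simp only [this]
      simp
    · intro f _
      exact (ENNReal.continuous_ofReal.comp ((continuous_minor hp _).pow 2)).measurable
  have hcard : (Finset.univ.filter fun f : Fin p → Fin d => Function.Injective f).card =
      p.factorial * d.choose p := by
    rw [← Nat.descFactorial_eq_factorial_mul_choose, ← Fintype.card_subtype,
      Fintype.card_congr (Equiv.subtypeInjectiveEquivEmbedding (Fin p) (Fin d)),
      Fintype.card_embedding_eq]
    simp
  simp_rw [hterm] at hsum
  rw [← Finset.sum_filter, Finset.sum_const, hcard, nsmul_eq_mul, Nat.cast_mul, mul_assoc] at hsum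
  have hp0 : (p.factorial : ENNReal) ≠ 0 := by exact_mod_cast p.factorial_ne_zero
  have h1 : (d.choose p : ENNReal) * I = 1 := by
    have := (ENNReal.mul_right_inj hp0 (ENNReal.natCast_ne_top _)).1 (hsum.trans (mul_one _).symm)
    exact this
  exact ENNReal.eq_inv_of_mul_eq_one_left (by rwa [mul_comm] at h1)

end OrthGroup

/-! ### The mean determinant over the Grassmannian -/

theorem Grass.continuous_starProjection (p d : ℕ) :
    Continuous fun L : Grass p d => L.1.starProjection :=
  continuous_induced_dom

theorem Grass.continuous_starProjection_orthogonal (p d : ℕ) :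
    Continuous fun L : Grass p d => L.1ᗮ.starProjection := by
  simp_rw [Submodule.starProjection_orthogonal']
  exact continuous_const.sub (Grass.continuous_starProjection p d)

theorem Grass.continuous_projSum {p d : ℕ} (P : Submodule ℝ (Eucl d)) :
    Continuous fun L : Grass p d => L.1.projSum P :=
  ((Grass.continuous_starProjection p d).mul continuous_const).add
    ((Grass.continuous_starProjection_orthogonal p d).mul continuous_const)

theorem Grass.exists_rotate_coord_eq {p d : ℕ} (hp : p ≤ d) (P : Grass p d) :
    ∃ V : OrthGroup d, Grass.rotate V (Grass.coord hp) = P := by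
  let b := (stdOrthonormalBasis ℝ P.1).reindex (finCongr P.2)
  have hb : Orthonormal ℝ fun i => (b i : Eucl d) := b.orthonormal.comp_linearIsometry P.1.subtypeₗᵢ
  obtain ⟨V, hV⟩ := OrthGroup.exists_isom_eq hp hb
  refine ⟨V, Subtype.ext ?_⟩
  have h1 : (Grass.rotate V (Grass.coord hp)).1 =
      Submodule.span ℝ (Set.range fun i => (b i : Eucl d)) := by
    simp only [Grass.rotate, Grass.coord, Submodule.map_span, ← Set.range_comp]
    congr 2
    funext i
    exact hV i
  rw [h1]
  have h2 := congrArg (Submodule.map P.1.subtype) b.toBasis.span_eq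
  rw [Submodule.map_span, ← Set.range_comp, Submodule.map_top, Submodule.range_subtype] at h2
  refine Eq.trans ?_ h2
  rw [OrthonormalBasis.coe_toBasis]
  rfl

theorem Grass.abs_det_projSum_rotate {p d : ℕ} (hp : p ≤ d) (U V : OrthGroup d) :
    |LinearMap.det ((Grass.rotate U (Grass.coord hp)).1.projSum
      (Grass.rotate V (Grass.coord hp)).1 : Eucl d →ₗ[ℝ] Eucl d)| =
    OrthGroup.minor hp (fun j => OrthGroup.isom V
      (EuclideanSpace.basisFun (Fin d) ℝ (Fin.castLE hp j))) U ^ 2 := by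
  obtain ⟨q, rfl⟩ := Nat.exists_eq_add_of_le hp
  let b : OrthGroup (p + q) → OrthonormalBasis (Fin p ⊕ Fin q) ℝ (Eucl (p + q)) := fun U =>
    ((EuclideanSpace.basisFun (Fin (p + q)) ℝ).map (OrthGroup.isom U)).reindex finSumFinEquiv.symm
  have hb : ∀ U i, b U (Sum.inl i) =
      OrthGroup.isom U (EuclideanSpace.basisFun (Fin (p + q)) ℝ (Fin.castLE hp i)) := by
    intro U i
    simp only [b, OrthonormalBasis.reindex_apply, Equiv.symm_symm, OrthonormalBasis.map_apply]
    rfl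
  have hspan : ∀ U, (Grass.rotate U (Grass.coord hp)).1 =
      Submodule.span ℝ (Set.range fun k => b U (Sum.inl k)) := by
    intro U
    simp_rw [hb]
    simp only [Grass.rotate, Grass.coord, Submodule.map_span, ← Set.range_comp]
    rfl
  rw [hspan U, hspan V, Submodule.abs_det_projSum]
  simp_rw [hb]
  rfl

theorem Grass.lintegral_abs_det_projSum {p d : ℕ} (hp : p ≤ d) (P : Grass p d) :
    ∫⁻ L : Grass p d, ENNReal.ofReal |LinearMap.det (L.1.projSum P.1 : Eucl d →ₗ[ℝ] Eucl d)|
      ∂grassMeasure hp = (d.choose p : ENNReal)⁻¹ := by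
  have hcont : Continuous fun L : Grass p d =>
      ENNReal.ofReal |LinearMap.det (L.1.projSum P.1 : Eucl d →ₗ[ℝ] Eucl d)| :=
    ENNReal.continuous_ofReal.comp (continuous_abs.comp
      (ContinuousLinearMap.continuous_det.comp (Grass.continuous_projSum P.1)))
  rw [grassMeasure, lintegral_map hcont.measurable (Grass.continuous_rotate _).measurable]
  obtain ⟨V, rfl⟩ := Grass.exists_rotate_coord_eq hp P
  simp_rw [Grass.abs_det_projSum_rotate]
  refine OrthGroup.lintegral_minor_sq hp ?_
  exact ((EuclideanSpace.basisFun (Fin d) ℝ).orthonormal.comp _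
    (Fin.castLE_injective hp)).comp_linearIsometryEquiv _

/-! ### Tiles -/

/-- The projection condition fixes the `L`-component of x, and the intersection condition fixes its
`Lᗮ`-component. -/
theorem mem_tile_iff {p d : ℕ} {K F : Set (Eucl d)} {x : Eucl d} {L : Grass p d} :
    (x, L) ∈ tile p K F ↔
      ∃ u ∈ K, ∃ v ∈ F, x = L.1.starProjection u + L.1ᗮ.starProjection v := by
  have hdir : (L.through x).direction = L.1 := AffineSubspace.direction_mk' x L.1
  have h1 : ∀ u, (EuclideanGeometry.orthogonalProjection (L.through x) u : Eucl d) = x ↔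
      L.1.starProjection x = L.1.starProjection u := by
    intro u
    rw [EuclideanGeometry.coe_orthogonalProjection_eq_iff_mem, hdir, vsub_eq_sub,
      ← Submodule.starProjection_apply_eq_zero_iff, map_sub, sub_eq_zero, eq_comm]
    exact and_iff_right (AffineSubspace.self_mem_mk' x L.1)
  have h2 : ∀ v, v ∈ L.through x ↔ L.1ᗮ.starProjection x = L.1ᗮ.starProjection v := by
    intro v
    have : v ∈ L.through x ↔ v - x ∈ L.1 := AffineSubspace.mem_mk'
    rw [this]
    conv_lhs => rw [← L.1.orthogonal_orthogonal]
    rw [← Submodule.starProjection_apply_eq_zero_iff, map_sub, sub_eq_zero, eq_comm]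
  have h3 : ∀ u v, x = L.1.starProjection u + L.1ᗮ.starProjection v ↔
      L.1.starProjection x = L.1.starProjection u ∧
        L.1ᗮ.starProjection x = L.1ᗮ.starProjection v := by
    intro u v
    constructor
    · rintro rfl
      have hu : L.1.starProjection u ∈ L.1 := L.1.starProjection_apply_mem u
      have hv : L.1ᗮ.starProjection v ∈ L.1ᗮ := L.1ᗮ.starProjection_apply_mem v
      simp only [map_add]
      rw [Submodule.starProjection_eq_self_iff.2 hu, Submodule.starProjection_eq_self_iff.2 hv,
        (Submodule.starProjection_apply_eq_zero_iff L.1).2 hv,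
        (Submodule.starProjection_apply_eq_zero_iff L.1ᗮ).2
          (L.1.le_orthogonal_orthogonal hu)]
      simp
    · rintro ⟨h, h'⟩
      rw [← h, ← h', L.1.starProjection_add_starProjection_orthogonal]
  constructor
  · rintro ⟨⟨u, hu, hux⟩, v, hvx, hv⟩
    exact ⟨u, hu, v, hv, (h3 u v).2 ⟨(h1 u).1 hux, (h2 v).1 hvx⟩⟩
  · rintro ⟨u, hu, v, hv, h⟩
    exact ⟨⟨u, hu, (h1 u).2 ((h3 u v).1 h).1⟩, v, (h2 v).2 ((h3 u v).1 h).2, hv⟩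

instance Grass.instSecondCountableTopology (p d : ℕ) : SecondCountableTopology (Grass p d) :=
  TopologicalSpace.secondCountableTopology_induced _ _ _

/-- The tile is the projection of a closed set along the compact factor `K × F`. -/
theorem isClosed_tile {p d : ℕ} {K F : Set (Eucl d)} (hK : IsCompact K) (hF : IsCompact F) :
    IsClosed (tile p K F) := by
  have := isCompact_iff_compactSpace.1 hK
  have := isCompact_iff_compactSpace.1 hF
  set C : Set ((K × F) × (Eucl d × Grass p d)) :=
    {z | z.2.1 = z.2.2.1.starProjection z.1.1 + z.2.2.1ᗮ.starProjection z.1.2} with hC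
  have hCc : IsClosed C := by
    refine isClosed_eq (by fun_prop) (Continuous.add ?_ ?_)
    · exact ((Grass.continuous_starProjection p d).comp (by fun_prop :
        Continuous fun z : (K × F) × (Eucl d × Grass p d) => z.2.2)).clm_apply (by fun_prop)
    · exact ((Grass.continuous_starProjection_orthogonal p d).comp (by fun_prop :
        Continuous fun z : (K × F) × (Eucl d × Grass p d) => z.2.2)).clm_apply (by fun_prop)
  have : tile p K F = Prod.snd '' C := by
    ext ⟨x, L⟩
    rw [mem_tile_iff]
    constructor
    · rintro ⟨u, hu, v, hv, h⟩
      exact ⟨((⟨u, hu⟩, ⟨v, hv⟩), (x, L)), h, rfl⟩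
    · rintro ⟨⟨⟨u, v⟩, q⟩, h, rfl⟩
      exact ⟨u, u.2, v, v.2, h⟩
  rw [this]
  exact isClosedMap_snd_of_compactSpace _ hCc

theorem measurableSet_tile {p d : ℕ} {K F : Set (Eucl d)} (hK : IsCompact K) (hF : IsClosed F) :
    MeasurableSet (tile p K F) := by
  -- A Voronoi cell may be unbounded, so it is exhausted by compact pieces.
  have : tile p K F = ⋃ n : ℕ, tile p K (F ∩ Metric.closedBall 0 n) := by
    ext ⟨x, L⟩
    simp only [Set.mem_iUnion, mem_tile_iff]
    constructor
    · rintro ⟨u, hu, v, hv, h⟩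
      obtain ⟨n, hn⟩ := exists_nat_ge ‖v‖
      exact ⟨n, u, hu, v, ⟨hv, by simpa using hn⟩, h⟩
    · rintro ⟨n, u, hu, v, hv, h⟩
      exact ⟨u, hu, v, hv.1, h⟩
  rw [this]
  exact MeasurableSet.iUnion fun n =>
    (isClosed_tile hK ((isCompact_closedBall _ _).inter_left hF)).measurableSet

/-! ### Volume of the tile of two sets in orthogonal affine subspaces -/

section Orthogonal

variable {E : Type*} [NormedAddCommGroup E] [InnerProductSpace ℝ E] [FiniteDimensional ℝ E]
  [MeasurableSpace E] [BorelSpace E]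

theorem volume_coe_preimage_translate (P : Submodule ℝ E) {K : Set E} {a : E}
    (ha : ∀ u ∈ K, u - a ∈ P) :
    volume {w : P | (w : E) + a ∈ K} = μHE[finrank ℝ P] K := by
  have himg : K = (fun w : P => (w : E) + a) '' {w : P | (w : E) + a ∈ K} := by
    ext u
    constructor
    · intro hu
      exact ⟨⟨u - a, ha u hu⟩, by simpa using hu, by simp⟩
    · rintro ⟨w, hw, rfl⟩
      exact hw
  have hiso : Isometry fun w : P => (w : E) + a :=
    (isometry_add_right a).comp isometry_subtype_coe
  conv_rhs => rw [himg, hiso.euclideanHausdorffMeasure_image,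
    InnerProductSpace.euclideanHausdorffMeasure_eq_volume]

theorem volume_orthogonal_sum (P : Submodule ℝ E) {K F : Set E} {a b : E}
    (ha : ∀ u ∈ K, u - a ∈ P) (hb : ∀ v ∈ F, v - b ∈ Pᗮ) :
    volume {w : E | P.starProjection w + a ∈ K ∧ Pᗮ.starProjection w + b ∈ F} =
      μHE[finrank ℝ P] K * μHE[finrank ℝ Pᗮ] F := by
  have h := (P.measurePreserving_measurableEquivProd (0 : E)).measure_preimage_equiv
    ({w : P | (w : E) + a ∈ K} ×ˢ {w : Pᗮ | (w : E) + b ∈ F})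
  rw [InnerProductSpace.euclideanHausdorffMeasure_eq_volume, Measure.volume_eq_prod,
    Measure.prod_prod, volume_coe_preimage_translate P ha,
    volume_coe_preimage_translate Pᗮ hb] at h
  rw [← h]
  congr 1
  ext w
  simp only [Set.mem_preimage, Submodule.measurableEquivProd_apply, vsub_eq_sub, sub_zero]
  rfl

end Orthogonal

/-- The linear image formula also covers singular maps: if the determinant vanishes, both sides are
0, even when `F` has infinite measure, because 0 · ∞ = 0. -/
theorem volume_tile_fiber {p d : ℕ} (P L : Grass p d) {K F : Set (Eucl d)} {a b : Eucl d}
    (ha : ∀ u ∈ K, u - a ∈ P.1) (hb : ∀ v ∈ F, v - b ∈ P.1ᗮ) :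
    volume ((fun x => (x, L)) ⁻¹' tile p K F) =
      ENNReal.ofReal |LinearMap.det (L.1.projSum P.1 : Eucl d →ₗ[ℝ] Eucl d)| *
        (μHE[p] K * μHE[d - p] F) := by
  have hperp : finrank ℝ P.1ᗮ = d - p := by
    have := P.1.finrank_add_finrank_orthogonal
    rw [P.2, finrank_euclideanSpace_fin] at this
    omega
  have hvol := volume_orthogonal_sum P.1 ha hb
  rw [P.2, hperp] at hvol
  rw [← hvol, ← Measure.addHaar_image_linearMap,
    ← measure_preimage_add_right volume (L.1.starProjection a + L.1ᗮ.starProjection b)]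
  congr 1
  ext x
  simp only [Set.mem_preimage, mem_tile_iff, Set.mem_image, Set.mem_ofPred_eq]
  have hT : ∀ w, (L.1.projSum P.1 : Eucl d →ₗ[ℝ] Eucl d) w =
      L.1.starProjection (P.1.starProjection w) + L.1ᗮ.starProjection (P.1ᗮ.starProjection w) :=
    fun w => rfl
  constructor
  · rintro ⟨u, hu, v, hv, h⟩
    have h1 : P.1.starProjection ((u - a) + (v - b)) = u - a := by
      rw [map_add, Submodule.starProjection_eq_self_iff.2 (ha u hu),
        (Submodule.starProjection_apply_eq_zero_iff _).2 (hb v hv), add_zero]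
    have h2 : P.1ᗮ.starProjection ((u - a) + (v - b)) = v - b := by
      rw [map_add, Submodule.starProjection_eq_self_iff.2 (hb v hv),
        (Submodule.starProjection_apply_eq_zero_iff _).2
          (P.1.le_orthogonal_orthogonal (ha u hu)), zero_add]
    refine ⟨(u - a) + (v - b), ⟨by simpa [h1] using hu, by simpa [h2] using hv⟩, ?_⟩
    rw [hT, h1, h2, map_sub, map_sub]
    rw [← eq_sub_iff_add_eq] at h
    rw [h]
    abel
  · rintro ⟨w, ⟨hu, hv⟩, rfl⟩
    refine ⟨_, hu, _, hv, ?_⟩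
    rw [hT, map_add, map_add]
    abel

theorem prod_grassMeasure_tile {p d : ℕ} (hp : p ≤ d) (P : Grass p d) {K F : Set (Eucl d)}
    (hK : IsCompact K) (hF : IsClosed F) {a b : Eucl d}
    (ha : ∀ u ∈ K, u - a ∈ P.1) (hb : ∀ v ∈ F, v - b ∈ P.1ᗮ) :
    ((volume : Measure (Eucl d)).prod (grassMeasure hp)) (tile p K F) =
      μHE[p] K * μHE[d - p] F / (d.choose p : ENNReal) := by
  -- Slicing over `L` first leaves only the determinant dependent on `L`.
  rw [Measure.prod_apply_symm (measurableSet_tile hK hF)]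
  simp_rw [volume_tile_fiber P _ ha hb]
  rw [lintegral_mul_const, Grass.lintegral_abs_det_projSum, mul_comm, ENNReal.div_eq_inv_mul,
    mul_comm]
  exact (ENNReal.continuous_ofReal.comp (continuous_abs.comp
    (ContinuousLinearMap.continuous_det.comp (Grass.continuous_projSum P.1)))).measurable

/-! ### Delaunay cells and their dual Voronoi cells -/

theorem isClosed_voronoiDomain {d : ℕ} (A : Set (Eucl d)) (a : Eucl d) :
    IsClosed (voronoiDomain A a) := by
  simp only [voronoiDomain, Set.ofPred_forall]
  exact isClosed_biInter fun b _ => isClosed_le (by fun_prop) (by fun_prop)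

theorem isClosed_dualVoronoi {d : ℕ} (A γ : Set (Eucl d)) : IsClosed (dualVoronoi A γ) :=
  isClosed_biInter fun a _ => isClosed_voronoiDomain A a

theorem finite_nearestSites {d : ℕ} {A : Set (Eucl d)}
    (hA : ∀ K : Set (Eucl d), IsCompact K → (A ∩ K).Finite) (x : Eucl d) :
    (nearestSites A x).Finite := by
  rcases (nearestSites A x).eq_empty_or_nonempty with h | ⟨a, ha⟩
  · simp [h]
  · refine (hA _ (isCompact_closedBall x (dist x a))).subset fun b hb => ⟨hb.1, ?_⟩
    rw [Metric.mem_closedBall, dist_comm]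
    exact hb.2 a ha.1

theorem isCompact_of_mem_delaunay {d : ℕ} {A γ : Set (Eucl d)}
    (hA : ∀ K : Set (Eucl d), IsCompact K → (A ∩ K).Finite) (hγ : γ ∈ delaunay A) :
    IsCompact γ := by
  obtain ⟨x, -, rfl⟩ := hγ
  exact (finite_nearestSites hA x).isCompact_convexHull ℝ

/-- Both points are equidistant from any two sites spanning γ, so they lie in the bisector of these
sites and their difference is orthogonal to the edge vector. -/
theorem sub_mem_orthogonal_of_mem_dualVoronoi {d : ℕ} {A γ : Set (Eucl d)}
    (hγ : γ ∈ delaunay A) {v w : Eucl d} (hv : v ∈ dualVoronoi A γ) (hw : w ∈ dualVoronoi A γ) :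
    v - w ∈ (affineSpan ℝ γ).directionᗮ := by
  obtain ⟨x, -, rfl⟩ := hγ
  set S := nearestSites A x
  have hmem : ∀ y ∈ dualVoronoi A (convexHull ℝ S), ∀ s ∈ S, y ∈ voronoiDomain A s :=
    fun y hy s hs => Set.mem_iInter₂.1 hy s ⟨hs.1, subset_convexHull ℝ S hs⟩
  have heq : ∀ y ∈ dualVoronoi A (convexHull ℝ S), ∀ s ∈ S, ∀ t ∈ S, dist s y = dist t y :=
    fun y hy s hs t ht => by
      rw [dist_comm s, dist_comm t]
      exact le_antisymm (hmem y hy s hs t ht.1) (hmem y hy t ht s hs.1)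
  rw [affineSpan_convexHull, direction_affineSpan, vectorSpan_def, Submodule.mem_orthogonal]
  intro u hu
  induction hu using Submodule.span_induction with
  | mem y hy =>
    obtain ⟨s, hs, t, ht, rfl⟩ := hy
    rw [real_inner_comm]
    exact EuclideanGeometry.inner_vsub_vsub_of_dist_eq_of_dist_eq
      (heq w hw t ht s hs) (heq v hv t ht s hs)
  | zero => simp
  | add y z _ _ hy hz => simp [inner_add_left, hy, hz]
  | smul r y _ hy => simp [inner_smul_left, hy]

theorem lemma3 {p d : ℕ} (hp : p ≤ d) (A : Set (Eucl d))
    (hA : ∀ K : Set (Eucl d), IsCompact K → (A ∩ K).Finite)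
    (γ : Set (Eucl d)) (hγ : γ ∈ delaunay A) (hdim : cellDim γ = p) :
    MeasurableSet (tile p γ (dualVoronoi A γ)) ∧
      ((volume : Measure (Eucl d)).prod (grassMeasure hp)) (tile p γ (dualVoronoi A γ)) =
        μHE[p] γ * μHE[d - p] (dualVoronoi A γ) / (d.choose p : ENNReal) := by
  have hK := isCompact_of_mem_delaunay hA hγ
  have hF := isClosed_dualVoronoi A γ
  refine ⟨measurableSet_tile hK hF, ?_⟩
  have ha : ∃ a, ∀ u ∈ γ, u - a ∈ (affineSpan ℝ γ).direction := by
    rcases γ.eq_empty_or_nonempty with h | ⟨a, ha⟩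
    · exact ⟨0, fun u hu => by simp [h] at hu⟩
    · exact ⟨a, fun u hu => AffineSubspace.vsub_mem_direction (subset_affineSpan ℝ γ hu)
        (subset_affineSpan ℝ γ ha)⟩
  have hb : ∃ b, ∀ v ∈ dualVoronoi A γ, v - b ∈ (affineSpan ℝ γ).directionᗮ := by
    rcases (dualVoronoi A γ).eq_empty_or_nonempty with h | ⟨b, hb⟩
    · exact ⟨0, fun v hv => by simp [h] at hv⟩
    · exact ⟨b, fun v hv => sub_mem_orthogonal_of_mem_dualVoronoi hγ hv hb⟩
  obtain ⟨a, ha⟩ := ha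
  obtain ⟨b, hb⟩ := hb
  exact prod_grassMeasure_tile hp ⟨(affineSpan ℝ γ).direction, hdim⟩ hK hF ha hb
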